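/- Let $n\ge 1$, let $M\in M_n(\mathbb{R})$ be an expanding matrix (all its eigenvalues have modulus $>1$), let $D\subset\mathbb{R}^n$ be a finite nonempty digit set, and let $\mu_{M,D}$ be the self-affine measure of $(M,D)$, i.e. the unique Borel probability measure $\mu$ on $\mathbb{R}^n$ with $$\mu=\frac1{|D|}\sum_{d\in D}\mu\circ\phi_d^{-1},\qquad \phi_d(x)=M^{-1}(x+d).$$ Let $m_D(x)=\frac{1}{|D|}\sum_{d\in D}e^{2\pi i\langle d,x\rangle}$, let $\mathcal Z(m_D)=\{x\in\mathbb{R}^n: m_D(x)=0\}$, and let $M^*$ be the conjugate transpose of $M$. Suppose that there exist a real $L>0$ and an integer $j_0\ge 2$ such that $$\emptyset\ne \bigl(L(\mathcal Z(m_D)-\mathcal Z(m_D))\bigr)\setminus\mathbb{Z}^n\subset L\,\mathcal Z(m_D),$$ $$\Bigl(L\bigcup_{j=1}^{j_0-1}M^{*j}\mathcal Z(m_D)\Bigr)\cap\mathbb{Z}^n=\emptyset\quad\text{and}\quad L\,M^{*j}\mathcal Z(m_D)\subset\mathbb{Z}^n\ \text{ for all } j\ge j_0 .$$ Then $\mu_{M,D}$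 is not a spectral measure: there is no countable set $\Lambda\subset\mathbb{R}^n$ such that $\{e^{2\pi i\langle\lambda,x\rangle}:\lambda\in\Lambda\}$ is an orthonormal basis of $L^2(\mu_{M,D})$. -/

import Mathlib

open scoped Pointwise Matrix

namespace SelfAffine

open MeasureTheory ProbabilityTheory Filter Topology
open scoped ENNReal NNReal RealInnerProductSpace

/-- A real square matrix is expanding if all its (complex) eigenvalues have modulus `> 1`. -/
def IsExpanding {n : ℕ} (M : Matrix (Fin n) (Fin n) ℝ) : Prop :=
  ∀ z ∈ spectrum ℂ (M.map ((↑) : ℝ → ℂ)), 1 < ‖z‖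

theorem summable_norm_pow_of_spectrum {A : Type*} [NormedRing A] [NormedAlgebra ℂ A]
    [CompleteSpace A] (a : A) (h : ∀ z ∈ spectrum ℂ a, ‖z‖ < 1) :
    Summable fun k : ℕ => ‖a ^ k‖ := by
  rcases subsingleton_or_nontrivial A with hA | hA
  · have : (fun k : ℕ => ‖a ^ k‖) = fun _ => 0 := by
      funext k; rw [Subsingleton.elim (a ^ k) 0, norm_zero]
    rw [this]; exact summable_zero
  have hr : spectralRadius ℂ a < 1 := by
    have := spectrum.spectralRadius_lt_of_forall_lt a (r := 1) (fun z hz => by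
      have := h z hz
      exact_mod_cast this)
    simpa using this
  obtain ⟨r, hr1, hr2⟩ := exists_between hr
  lift r to ℝ≥0 using (hr2.trans ENNReal.one_lt_top).ne
  have ht := spectrum.pow_nnnorm_pow_one_div_tendsto_nhds_spectralRadius a
  have hev := ht.eventually (gt_mem_nhds hr1)
  have hr3 : (r : ℝ) < 1 := by exact_mod_cast hr2
  refine Summable.of_norm_bounded_eventually_nat
    (summable_geometric_of_lt_one r.coe_nonneg hr3) ?_
  filter_upwards [hev, eventually_gt_atTop 0] with k hk hk0
  have hk' : (‖a ^ k‖₊ : ℝ≥0∞) ≤ (r : ℝ≥0∞) ^ k := by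
    have h1 := ENNReal.rpow_le_rpow hk.le (z := (k : ℝ)) (by positivity)
    rw [← ENNReal.rpow_mul, one_div, inv_mul_cancel₀ (by positivity), ENNReal.rpow_one,
      ENNReal.rpow_natCast] at h1
    exact h1
  rw [norm_norm]
  exact_mod_cast hk'

theorem exists_bound_of_linear {V W : Type*} [NormedAddCommGroup V] [NormedSpace ℝ V]
    [FiniteDimensional ℝ V] [NormedAddCommGroup W] [NormedSpace ℝ W] (f : V →ₗ[ℝ] W) :
    ∃ C : ℝ, ∀ x, ‖f x‖ ≤ C * ‖x‖ :=
  ⟨‖LinearMap.toContinuousLinearMap f‖, (LinearMap.toContinuousLinearMap f).le_opNorm⟩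

section MatrixNorm

attribute [local instance] Matrix.linftyOpNormedRing Matrix.linftyOpNormedAlgebra

theorem IsExpanding.summable {n : ℕ} {M : Matrix (Fin n) (Fin n) ℝ} (hM : IsExpanding M) :
    Summable fun k : ℕ => ‖(Matrix.toEuclideanCLM (n := Fin n) (𝕜 := ℝ) M⁻¹) ^ k‖ := by
  set N : Matrix (Fin n) (Fin n) ℂ := M.map ((↑) : ℝ → ℂ) with hN
  have hNM : N = (Complex.ofRealHom).mapMatrix M := rfl
  have hNu : IsUnit N := by
    rw [← spectrum.zero_notMem_iff ℂ]
    intro h0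
    have := hM 0 h0
    simp at this
    linarith
  have hMu : IsUnit M := by
    rw [Matrix.isUnit_iff_isUnit_det, isUnit_iff_ne_zero] at hNu ⊢
    rw [hNM, ← RingHom.map_det] at hNu
    intro h; apply hNu; rw [h]; simp
  obtain ⟨u, hu⟩ := hMu
  have hinv : M⁻¹ = ((u⁻¹ : (Matrix (Fin n) (Fin n) ℝ)ˣ) : Matrix (Fin n) (Fin n) ℝ) := by
    rw [Matrix.coe_units_inv, hu]
  let v := Units.map (Complex.ofRealHom.mapMatrix : Matrix (Fin n) (Fin n) ℝ →+* _).toMonoidHom u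
  have hv : (v : Matrix (Fin n) (Fin n) ℂ) = N := by
    rw [hNM, ← hu]; rfl
  have hvi : ((v⁻¹ : (Matrix (Fin n) (Fin n) ℂ)ˣ) : Matrix (Fin n) (Fin n) ℂ)
      = Complex.ofRealHom.mapMatrix M⁻¹ := by
    rw [hinv]; rfl
  have hs := summable_norm_pow_of_spectrum
    ((v⁻¹ : (Matrix (Fin n) (Fin n) ℂ)ˣ) : Matrix (Fin n) (Fin n) ℂ) (by
      intro z hz
      rw [← spectrum.map_inv, Set.mem_inv, hv] at hz
      have := hM _ hz
      rw [norm_inv] at this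
      exact (one_lt_inv_iff₀.1 this).2)
  obtain ⟨C, hC⟩ := exists_bound_of_linear
    ((Matrix.toEuclideanCLM (n := Fin n) (𝕜 := ℝ)).toAlgEquiv.toLinearMap)
  refine Summable.of_nonneg_of_le (fun _ => norm_nonneg _) (fun k => ?_) (hs.mul_left C)
  have h1 : ‖((v⁻¹ : (Matrix (Fin n) (Fin n) ℂ)ˣ) : Matrix (Fin n) (Fin n) ℂ) ^ k‖ = ‖M⁻¹ ^ k‖ := by
    rw [hvi, ← map_pow]
    simp [Matrix.linfty_opNorm_def]
  rw [h1, ← map_pow]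
  exact hC (M⁻¹ ^ k)

end MatrixNorm

section Generic

variable {E : Type*} [NormedAddCommGroup E] [InnerProductSpace ℝ E] [FiniteDimensional ℝ E]
  [MeasurableSpace E] [BorelSpace E]

theorem charFun_eq_of_invariant (A : E →L[ℝ] E) (D : Finset E) (μ : Measure E)
    [IsProbabilityMeasure μ]
    (h : μ = (D.card : ℝ≥0∞)⁻¹ • ∑ d ∈ D, μ.map (fun x => A (x + d))) (t : E) :
    charFun μ t = ((D.card : ℂ)⁻¹ * ∑ d ∈ D, Complex.exp (⟪A d, t⟫ * Complex.I)) *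
      charFun μ (A.adjoint t) := by
  have hmeas : ∀ d : E, Measurable (fun x => A (x + d)) := fun d => by fun_prop
  have hint : ∀ d ∈ D, Integrable (fun x : E => Complex.exp (⟪x, t⟫ * Complex.I))
      (μ.map (fun x => A (x + d))) := by
    intro d _
    have := Measure.isProbabilityMeasure_map (μ := μ) (hmeas d).aemeasurable
    refine Integrable.of_bound (C := 1) (by fun_prop) (Eventually.of_forall fun x => ?_)
    rw [Complex.norm_exp_ofReal_mul_I]
  have e1 : charFun μ t = charFun ((D.card : ℝ≥0∞)⁻¹ • ∑ d ∈ D, μ.map (fun x => A (x + d))) t := by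
    rw [← h]
  rw [e1, charFun_apply, integral_smul_measure, integral_finsetSum_measure hint, mul_assoc,
    Finset.sum_mul]
  have e2 : ((D.card : ℝ≥0∞)⁻¹.toReal) = (D.card : ℝ)⁻¹ := by simp
  rw [e2, Complex.real_smul]
  push_cast
  congr 1
  refine Finset.sum_congr rfl fun d _ => ?_
  rw [integral_map (hmeas d).aemeasurable (by fun_prop), charFun_apply, ← integral_const_mul]
  refine integral_congr_ae (Eventually.of_forall fun x => ?_)
  simp only
  rw [← Complex.exp_add, ContinuousLinearMap.adjoint_inner_right, map_add, inner_add_left]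
  congr 1
  push_cast
  ring

theorem unique_of_invariant (A : E →L[ℝ] E) (hA : Summable fun k : ℕ => ‖A ^ k‖) (D : Finset E)
    (μ ν : Measure E) [IsProbabilityMeasure μ] [IsProbabilityMeasure ν]
    (hμ : μ = (D.card : ℝ≥0∞)⁻¹ • ∑ d ∈ D, μ.map (fun x => A (x + d)))
    (hν : ν = (D.card : ℝ≥0∞)⁻¹ • ∑ d ∈ D, ν.map (fun x => A (x + d))) : μ = ν := by
  refine Measure.ext_of_charFun (funext fun t => ?_)
  have hfac : ∀ s : E, ‖(D.card : ℂ)⁻¹ * ∑ d ∈ D, Complex.exp (⟪A d, s⟫ * Complex.I)‖ ≤ 1 := by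
    intro s
    rw [norm_mul, norm_inv, Complex.norm_natCast]
    refine inv_mul_le_one_of_le₀ ((norm_sum_le _ _).trans ?_) (Nat.cast_nonneg _)
    simp [Complex.norm_exp_ofReal_mul_I]
  have hstep : ∀ s : E, ‖charFun μ s - charFun ν s‖ ≤
      ‖charFun μ (A.adjoint s) - charFun ν (A.adjoint s)‖ := by
    intro s
    rw [charFun_eq_of_invariant A D μ hμ s, charFun_eq_of_invariant A D ν hν s, ← mul_sub,
      norm_mul]
    exact mul_le_of_le_one_left (norm_nonneg _) (hfac s)
  have hiter : ∀ k : ℕ, ‖charFun μ t - charFun ν t‖ ≤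
      ‖charFun μ ((A.adjoint ^ k) t) - charFun ν ((A.adjoint ^ k) t)‖ := by
    intro k
    induction k with
    | zero => simp
    | succ k ih =>
      refine ih.trans ((hstep _).trans (le_of_eq ?_))
      rw [pow_succ']
      rfl
  have hlim : Tendsto (fun k : ℕ => (A.adjoint ^ k) t) atTop (𝓝 0) := by
    refine squeeze_zero_norm (a := fun k => ‖A ^ k‖ * ‖t‖) (fun k => ?_) ?_
    · refine ((A.adjoint ^ k).le_opNorm t).trans (le_of_eq ?_)
      rw [← ContinuousLinearMap.star_eq_adjoint, ← star_pow, ContinuousLinearMap.star_eq_adjoint,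
        LinearIsometryEquiv.norm_map]
    · simpa using hA.tendsto_atTop_zero.mul_const ‖t‖
  have hc := ((continuous_charFun (μ := μ)).sub (continuous_charFun (μ := ν))).norm.tendsto 0
  have h0 := hc.comp hlim
  simp only [Pi.sub_apply, charFun_zero, probReal_univ, sub_self, norm_zero] at h0
  have h1 : ‖charFun μ t - charFun ν t‖ ≤ 0 := ge_of_tendsto' h0 hiter
  exact sub_eq_zero.1 (norm_le_zero_iff.1 h1)

/-- Appending an independent first coordinate to an i.i.d. sequence gives an i.i.d. sequence. -/
theorem map_cons_infinitePi {X : Type*} [MeasurableSpace X] (ν : Measure X)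
    [IsProbabilityMeasure ν] :
    (ν.prod (Measure.infinitePi fun _ : ℕ => ν)).map
      (fun p : X × (ℕ → X) => fun k : ℕ => Nat.casesOn (motive := fun _ => X) k p.1 p.2) =
      Measure.infinitePi fun _ : ℕ => ν := by
  have hm : Measurable
      (fun p : X × (ℕ → X) => fun k : ℕ => Nat.casesOn (motive := fun _ => X) k p.1 p.2) := by
    refine measurable_pi_lambda _ fun k => ?_
    cases k with
    | zero => exact measurable_fst
    | succ k => exact (measurable_pi_apply k).comp measurable_snd
  refine Measure.eq_infinitePi _ fun s t ht => ?_
  rw [Measure.map_apply hm (.pi s.countable_toSet fun _ _ => ht _)]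
  classical
  set t' : ℕ → Set X := fun i => if i ∈ s then t i else Set.univ with ht'
  obtain ⟨N, hN⟩ : ∃ N, s ⊆ Finset.range (N + 1) :=
    ⟨s.sup id, fun i hi => Finset.mem_range.2 (Nat.lt_succ_of_le (Finset.le_sup (f := id) hi))⟩
  have hpre : (fun p : X × (ℕ → X) => fun k : ℕ => Nat.casesOn (motive := fun _ => X) k p.1 p.2) ⁻¹'
      (Set.pi s t) = t' 0 ×ˢ Set.pi (Finset.range N) (fun i => t' (i + 1)) := by
    ext ⟨a, w⟩
    simp only [Set.mem_preimage, Set.mem_pi, Finset.mem_coe, Set.mem_prod, Finset.mem_range, ht']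
    constructor
    · intro h
      refine ⟨?_, fun i _ => ?_⟩
      · split_ifs with h0
        · exact h 0 h0
        · trivial
      · split_ifs with h0
        · exact h (i + 1) h0
        · trivial
    · rintro ⟨h0, h1⟩ i hi
      cases i with
      | zero => simpa [hi] using h0
      | succ i =>
        have := h1 i (by have := Finset.mem_range.1 (hN hi); omega)
        simpa [hi] using this
  have ht'm : ∀ i, MeasurableSet (t' i) := fun i => by
    simp only [ht']; split_ifs
    · exact ht i
    · exact .univ
  rw [hpre, Measure.prod_prod, Measure.infinitePi_pi _ (fun i _ => ht'm _)]
  have : ∏ i ∈ s, ν (t i) = ∏ i ∈ Finset.range (N + 1), ν (t' i) := by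
    rw [← Finset.prod_subset hN (f := fun i => ν (t' i))]
    · exact Finset.prod_congr rfl fun i hi => by simp [ht', hi]
    · intro i _ hi; simp [ht', hi]
  rw [this, Finset.prod_range_succ']
  rw [mul_comm]

theorem exists_invariant (A : E →L[ℝ] E) (hA : Summable fun k : ℕ => ‖A ^ k‖) (D : Finset E)
    (hD : D.Nonempty) : ∃ μ : Measure E, IsProbabilityMeasure μ ∧
      μ = (D.card : ℝ≥0∞)⁻¹ • ∑ d ∈ D, μ.map (fun x => A (x + d)) := by
  classical
  have hc0 : (D.card : ℝ≥0∞) ≠ 0 := by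
    simpa using hD.ne_empty
  let ν : Measure D := (D.card : ℝ≥0∞)⁻¹ • ∑ d : D, Measure.dirac d
  have hν : IsProbabilityMeasure ν := ⟨by
    simp [ν, ENNReal.inv_mul_cancel hc0 (ENNReal.natCast_ne_top _)]⟩
  let P : Measure (ℕ → D) := Measure.infinitePi fun _ => ν
  obtain ⟨R, hR⟩ : ∃ R : ℝ, ∀ d : D, ‖(d : E)‖ ≤ R :=
    ⟨∑ d ∈ D, ‖d‖, fun d => Finset.single_le_sum (f := fun d => ‖d‖) (fun _ _ => norm_nonneg _) d.2⟩
  have hbound : ∀ (k : ℕ) (w : ℕ → D), ‖(A ^ (k + 1)) (w k : E)‖ ≤ ‖A ^ (k + 1)‖ * R :=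
    fun k w => ((A ^ (k + 1)).le_opNorm _).trans
      (mul_le_mul_of_nonneg_left (hR _) (norm_nonneg _))
  have hsum : Summable fun k : ℕ => ‖A ^ (k + 1)‖ * R :=
    ((summable_nat_add_iff 1).2 hA).mul_right R
  let S : (ℕ → D) → E := fun w => ∑' k, (A ^ (k + 1)) (w k : E)
  have hS : Measurable S := by
    refine Continuous.measurable (continuous_tsum (fun k => ?_) hsum hbound)
    fun_prop
  let c : D × (ℕ → D) → (ℕ → D) := fun p k => Nat.casesOn (motive := fun _ => D) k p.1 p.2
  have hcm : Measurable c := by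
    refine measurable_pi_lambda _ fun k => ?_
    cases k with
    | zero => exact measurable_fst
    | succ k => exact (measurable_pi_apply k).comp measurable_snd
  have hSc : ∀ d w, S (c (d, w)) = A (S w + d) := by
    intro d w
    have hs : ∀ w : ℕ → D, Summable fun k : ℕ => (A ^ (k + 1)) (w k : E) := fun w =>
      Summable.of_norm_bounded hsum fun k => hbound k w
    simp only [S]
    rw [(hs _).tsum_eq_zero_add, map_add, A.map_tsum (hs w), add_comm]
    congr 1
    · refine tsum_congr fun k => ?_
      rw [pow_succ' A (k + 1)]
      rfl
  have hP : (ν.prod P).map c = P := map_cons_infinitePi ν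
  refine ⟨P.map S, Measure.isProbabilityMeasure_map hS.aemeasurable, ?_⟩
  ext B hB
  have hmeas : ∀ d : E, Measurable (fun x => A (x + d)) := fun d => by fun_prop
  rw [Measure.map_apply hS hB]
  conv_lhs => rw [← hP]
  rw [Measure.map_apply hcm (hS hB), Measure.prod_apply (hcm (hS hB))]
  rw [lintegral_smul_measure, lintegral_finsetSum_measure, Measure.smul_apply,
    Measure.finsetSum_apply, ← Finset.sum_coe_sort D]
  congr 1
  refine Finset.sum_congr rfl fun d _ => ?_
  rw [lintegral_dirac, Measure.map_apply (hmeas d) hB, Measure.map_apply hS (hmeas d hB)]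
  congr 1
  ext w
  simp only [Set.mem_preimage, hSc]

end Generic

/-- The self-affinity equation `μ = |D|⁻¹ ∑_{d ∈ D} μ ∘ φ_d⁻¹` with `φ_d x = M⁻¹ (x + d)`, for a
Borel probability measure `μ` on `ℝⁿ`. -/
def IsSelfAffineMeasure {n : ℕ} (M : Matrix (Fin n) (Fin n) ℝ)
    (D : Finset (EuclideanSpace ℝ (Fin n))) (μ : Measure (EuclideanSpace ℝ (Fin n))) : Prop :=
  IsProbabilityMeasure μ ∧
    μ = (D.card : ℝ≥0∞)⁻¹ •
      ∑ d ∈ D, μ.map (fun x => Matrix.toEuclideanCLM (n := Fin n) (𝕜 := ℝ) M⁻¹ (x + d))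

/-- Existence and uniqueness of the self-affine measure. -/
theorem existsUnique_isSelfAffineMeasure {n : ℕ} {M : Matrix (Fin n) (Fin n) ℝ}
    {D : Finset (EuclideanSpace ℝ (Fin n))} (hM : IsExpanding M) (hD : D.Nonempty) :
    ∃! μ, IsSelfAffineMeasure M D μ := by
  obtain ⟨μ, hμ, h⟩ := exists_invariant _ hM.summable D hD
  refine ⟨μ, ⟨hμ, h⟩, ?_⟩
  rintro ν ⟨hν, h'⟩
  exact unique_of_invariant _ hM.summable D ν μ h' h

/-- The self-affine measure `μ_{M,D}`: the unique Borel probability measure satisfying the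
self-affinity equation. -/
noncomputable def selfAffineMeasure {n : ℕ} (M : Matrix (Fin n) (Fin n) ℝ)
    (D : Finset (EuclideanSpace ℝ (Fin n))) (hM : IsExpanding M) (hD : D.Nonempty) :
    Measure (EuclideanSpace ℝ (Fin n)) :=
  (existsUnique_isSelfAffineMeasure hM hD).choose

theorem isSelfAffineMeasure_selfAffineMeasure {n : ℕ} (M : Matrix (Fin n) (Fin n) ℝ)
    (D : Finset (EuclideanSpace ℝ (Fin n))) (hM : IsExpanding M) (hD : D.Nonempty) :
    IsSelfAffineMeasure M D (selfAffineMeasure M D hM hD) :=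
  (existsUnique_isSelfAffineMeasure hM hD).choose_spec.1

instance isProbabilityMeasure_selfAffineMeasure {n : ℕ} (M : Matrix (Fin n) (Fin n) ℝ)
    (D : Finset (EuclideanSpace ℝ (Fin n))) (hM : IsExpanding M) (hD : D.Nonempty) :
    IsProbabilityMeasure (selfAffineMeasure M D hM hD) :=
  (isSelfAffineMeasure_selfAffineMeasure M D hM hD).1

/-- The exponential `x ↦ e^{2πi⟨l, x⟩}`. -/
noncomputable def expFun {n : ℕ} (l x : EuclideanSpace ℝ (Fin n)) : ℂ :=
  Complex.exp (2 * Real.pi * Complex.I * (⟪l, x⟫ : ℝ))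

theorem memLp_expFun {n : ℕ} (μ : Measure (EuclideanSpace ℝ (Fin n))) [IsFiniteMeasure μ]
    (l : EuclideanSpace ℝ (Fin n)) : MemLp (expFun l) 2 μ := by
  refine MemLp.of_bound (C := 1) (Continuous.aestronglyMeasurable ?_)
    (Eventually.of_forall fun x => ?_)
  · unfold expFun; fun_prop
  · have : 2 * Real.pi * Complex.I * (⟪l, x⟫ : ℝ) = ((2 * Real.pi * ⟪l, x⟫ : ℝ) : ℂ) * Complex.I := by
      push_cast; ring
    rw [expFun, this, Complex.norm_exp_ofReal_mul_I]

/-- The exponential `e^{2πi⟨l, ·⟩}` as an element of `L²(μ)`. -/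
noncomputable def expLp {n : ℕ} (μ : Measure (EuclideanSpace ℝ (Fin n))) [IsFiniteMeasure μ]
    (l : EuclideanSpace ℝ (Fin n)) : Lp ℂ 2 μ :=
  (memLp_expFun μ l).toLp (expFun l)

/-- `S` is a spectrum of `μ`: it is countable and the exponentials `e^{2πi⟨l, ·⟩}`, `l ∈ S`, form
an orthonormal basis (in the Hilbert space sense) of `L²(μ)`. -/
def IsSpectrum {n : ℕ} (μ : Measure (EuclideanSpace ℝ (Fin n))) [IsFiniteMeasure μ]
    (S : Set (EuclideanSpace ℝ (Fin n))) : Prop :=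
  S.Countable ∧ ∃ b : HilbertBasis S ℂ (Lp ℂ 2 μ), ∀ l : S, b l = expLp μ l

/-- `μ` is a spectral measure if it has a spectrum. -/
def IsSpectralMeasure {n : ℕ} (μ : Measure (EuclideanSpace ℝ (Fin n))) [IsFiniteMeasure μ] : Prop :=
  ∃ S, IsSpectrum μ S

/-- The mask polynomial `m_D(x) = |D|⁻¹ ∑_{d ∈ D} e^{2πi⟨d, x⟩}`. -/
noncomputable def maskPolynomial {n : ℕ} (D : Finset (EuclideanSpace ℝ (Fin n)))
    (x : EuclideanSpace ℝ (Fin n)) : ℂ :=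
  (D.card : ℂ)⁻¹ * ∑ d ∈ D, expFun d x

/-- The zero set `Z(m_D)` of the mask polynomial. -/
def maskZeros {n : ℕ} (D : Finset (EuclideanSpace ℝ (Fin n))) : Set (EuclideanSpace ℝ (Fin n)) :=
  {x | maskPolynomial D x = 0}

/-- The integer lattice `ℤⁿ` in `ℝⁿ`. -/
def intLattice (n : ℕ) : Set (EuclideanSpace ℝ (Fin n)) :=
  {x | ∀ i, ∃ k : ℤ, x i = k}

end SelfAffine

open SelfAffine

namespace SelfAffine

open MeasureTheory ProbabilityTheory Filter Topology
open scoped ENNReal NNReal RealInnerProductSpace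

/-! Let `f` be the Fourier transform of the measure, `m` the mask polynomial, `B` the inverse of
`M*` and `G = L⁻¹ℤⁿ`. Iterating `f x = m (B x) * f (B x)` for `k = j₀ - 1` steps gives `f = P * g`,
where `P` collects the first `k` factors and `g = f ∘ B ^ k`. The hypotheses say that `P` has no
zero in `G` and that all zeros of `g` lie in `G`. So two distinct points of a spectrum `S` are
separated by `g` if they agree modulo `G`, and by `P` otherwise.

Both factors satisfy Bessel's inequality: `∑ ‖g (x - a)‖²` over a class modulo `G`, and `∑ ‖P (x -
a)‖²` over a transversal of the classes, are at most `1`. Since `∑ ‖P‖² ‖g‖² = 1` over all of `S`,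
equality holds throughout (`sum_mul_le_of_transversal`, `norm_sq_le_tsum_class`). Hence `‖P (x -
a)‖` does not depend on `a` in a class `C`, and the class alone is already complete for `g`.

Thus differences within `C` are periods of `‖P‖`. Together with the condition on `Z(m) - Z(m)`, this
puts `B ^ k (a - c)` in `G` for all `a, c ∈ C`. The rescaled class `B ^ k '' C` is complete for `f`
and lies in a single class, so the factor `P` can lose no mass: `‖P‖ = 1` everywhere. But `P` has
zeros. -/

/-! ### Bessel's inequality as a property of a function -/

/-- `f` satisfies Bessel's inequality: translates of `f` along a finite set whose differences are
zeros of `f` have square sum at most `1`. Fourier transforms of probability measures do. -/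
def IsBessel {E : Type*} [AddCommGroup E] (f : E → ℂ) : Prop :=
  ∀ T : Finset E, (∀ a ∈ T, ∀ b ∈ T, a ≠ b → f (a - b) = 0) →
    ∀ x, ∑ a ∈ T, ‖f (x - a)‖ ^ 2 ≤ 1

theorem IsBessel.norm_sq_le_one {E : Type*} [AddCommGroup E] {f : E → ℂ} (hf : IsBessel f) (x : E) :
    ‖f x‖ ^ 2 ≤ 1 := by
  have := hf {0} (by simp) x
  simpa using this

theorem IsBessel.comp_injective {E : Type*} [AddCommGroup E] {f : E → ℂ} (hf : IsBessel f)
    (B : E →+ E) (hB : Function.Injective B) : IsBessel fun x => f (B x) := by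
  classical
  intro T hT x
  have := hf (T.image B) (by
    simp only [Finset.mem_image]
    rintro _ ⟨a, ha, rfl⟩ _ ⟨b, hb, rfl⟩ hab
    rw [← map_sub]
    exact hT a ha b hb fun h => hab (by rw [h])) (B x)
  rw [Finset.sum_image fun a _ b _ h => hB h] at this
  simpa only [map_sub] using this

theorem IsBessel.sum_subtype_le {E : Type*} [AddCommGroup E] {f : E → ℂ} (hf : IsBessel f)
    {S : Set E} (hS : ∀ a ∈ S, ∀ b ∈ S, a ≠ b → f (a - b) = 0) (x : E) (F : Finset S) :
    ∑ a ∈ F, ‖f (x - a)‖ ^ 2 ≤ 1 := by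
  have := hf (F.map (Function.Embedding.subtype _)) (by
    simp only [Finset.mem_map]
    rintro _ ⟨a, -, rfl⟩ _ ⟨b, -, rfl⟩ hab
    exact hS a a.2 b b.2 hab) x
  simpa using this

theorem IsBessel.summable {E : Type*} [AddCommGroup E] {f : E → ℂ} (hf : IsBessel f)
    {S : Set E} (hS : ∀ a ∈ S, ∀ b ∈ S, a ≠ b → f (a - b) = 0) (x : E) :
    Summable fun a : S => ‖f (x - a)‖ ^ 2 :=
  summable_of_sum_le (fun _ => by positivity) (hf.sum_subtype_le hS x)

theorem IsBessel.tsum_le_one {E : Type*} [AddCommGroup E] {f : E → ℂ} (hf : IsBessel f)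
    {S : Set E} (hS : ∀ a ∈ S, ∀ b ∈ S, a ≠ b → f (a - b) = 0) (x : E) :
    ∑' a : S, ‖f (x - a)‖ ^ 2 ≤ 1 :=
  (hf.summable hS x).tsum_le_of_sum_le (hf.sum_subtype_le hS x)

/-! ### Equality cases in weighted sums and sums over classes -/

/-- If weights `v` have total mass at most `1` and `w` is bounded by its own weighted sum `s`, then
`w = s` on the support of `v`, and `v` has total mass `1` unless `s = 0`. -/
theorem eq_of_le_weighted_tsum {ι : Type*} {w v : ι → ℝ} {s : ℝ} (hv : ∀ i, 0 ≤ v i)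
    (hvs : Summable v) (hv1 : ∑' i, v i ≤ 1) (hs0 : 0 ≤ s) (hws : ∀ i, w i ≤ s)
    (hsum : Summable fun i => w i * v i) (hs : s ≤ ∑' i, w i * v i) :
    (∀ i, v i ≠ 0 → w i = s) ∧ (s ≠ 0 → ∑' i, v i = 1) := by
  have h1 : Summable fun i => (s - w i) * v i := by
    simpa only [sub_mul] using (hvs.mul_left s).sub hsum
  have h2 : ∑' i, (s - w i) * v i = s * ∑' i, v i - ∑' i, w i * v i := by
    simp only [sub_mul]
    rw [(hvs.mul_left s).tsum_sub hsum, tsum_mul_left]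
  have h0 : ∀ i, 0 ≤ (s - w i) * v i := fun i => mul_nonneg (sub_nonneg.2 (hws i)) (hv i)
  have h3 : s * ∑' i, v i ≤ s := mul_le_of_le_one_right hs0 hv1
  have h4 : 0 ≤ ∑' i, (s - w i) * v i := tsum_nonneg h0
  constructor
  · intro i hi
    have h5 : (s - w i) * v i ≤ 0 := (h1.le_tsum i fun j _ => h0 j).trans (by linarith)
    have h6 : (s - w i) * v i = 0 := le_antisymm h5 (h0 i)
    rcases mul_eq_zero.1 h6 with h | h
    · linarith
    · exact absurd h hi
  · intro hs'
    have h5 : s * ∑' i, v i = s * 1 := by linarith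
    exact mul_left_cancel₀ hs' h5

/-- Partition a finite weighted sum into classes, where each class has `v`-mass at most `1` and each
transversal has `w`-mass at most `1`. -/
theorem sum_mul_le_of_transversal {ι κ : Type*} [DecidableEq ι] [DecidableEq κ] (F : Finset ι)
    (cl : ι → κ) (w v : ι → ℝ) (hw : ∀ i, 0 ≤ w i) (hv : ∀ i, 0 ≤ v i)
    (hT : ∀ T : Finset ι, Set.InjOn cl T → ∑ i ∈ T, w i ≤ 1)
    (hC : ∀ c, ∑ i ∈ F with cl i = c, v i ≤ 1) (a : ι) :
    ∑ i ∈ F, w i * v i ≤ 1 - w a + ∑ i ∈ F with cl i = cl a, w i * v i := by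
  -- The class of `a` is left out because `a` itself represents it; each other class is represented
  -- by a maximiser of `w` on it.
  set K := (F.image cl).erase (cl a) with hK
  have hmax : ∀ c ∈ K, ∃ i, cl i = c ∧ ∀ j ∈ F, cl j = c → w j ≤ w i := by
    intro c hc
    obtain ⟨i₀, hi₀, h₀⟩ := Finset.mem_image.1 (Finset.mem_of_mem_erase hc)
    obtain ⟨i, hi, h⟩ := Finset.exists_max_image (F.filter fun i => cl i = c) w
      ⟨i₀, Finset.mem_filter.2 ⟨hi₀, h₀⟩⟩
    exact ⟨i, (Finset.mem_filter.1 hi).2, fun j hj hjc => h j (Finset.mem_filter.2 ⟨hj, hjc⟩)⟩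
  have : Nonempty ι := ⟨a⟩
  choose! r hr hrmax using hmax
  have haK : a ∉ K.image r := by
    intro h
    obtain ⟨c, hc, h⟩ := Finset.mem_image.1 h
    have := hr c hc
    rw [h] at this
    exact Finset.ne_of_mem_erase hc this.symm
  have hrinj : Set.InjOn r K := fun c hc d hd h => by rw [← hr c hc, h, hr d hd]
  have hsel := hT (insert a (K.image r)) (by
    intro i hi j hj hij
    simp only [Finset.coe_insert, Finset.coe_image, Set.mem_insert_iff, Set.mem_image,
      Finset.mem_coe] at hi hj
    rcases hi with rfl | ⟨c, hc, rfl⟩ <;> rcases hj with rfl | ⟨d, hd, rfl⟩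
    · rfl
    · rw [hr d hd] at hij
      exact absurd hij.symm (Finset.ne_of_mem_erase hd)
    · rw [hr c hc] at hij
      exact absurd hij (Finset.ne_of_mem_erase hc)
    · rw [hr c hc, hr d hd] at hij
      rw [hij])
  rw [Finset.sum_insert haK, Finset.sum_image hrinj] at hsel
  have hsplit : ∑ i ∈ F, w i * v i = ∑ i ∈ F with cl i = cl a, w i * v i +
      ∑ c ∈ K, ∑ i ∈ F with cl i = c, w i * v i := by
    rw [← Finset.sum_filter_add_sum_filter_not F fun i => cl i = cl a]
    congr 1
    rw [← Finset.sum_fiberwise_of_maps_to (t := K) (g := cl)]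
    · refine Finset.sum_congr rfl fun c hc => Finset.sum_congr ?_ fun _ _ => rfl
      ext i
      simp only [Finset.mem_filter]
      constructor
      · rintro ⟨⟨h1, _⟩, h2⟩; exact ⟨h1, h2⟩
      · rintro ⟨h1, h2⟩; exact ⟨⟨h1, h2 ▸ Finset.ne_of_mem_erase hc⟩, h2⟩
    · intro i hi
      rw [Finset.mem_filter] at hi
      exact Finset.mem_erase.2 ⟨hi.2, Finset.mem_image_of_mem _ hi.1⟩
  have hK' : ∑ c ∈ K, ∑ i ∈ F with cl i = c, w i * v i ≤ ∑ c ∈ K, w (r c) := by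
    refine Finset.sum_le_sum fun c hc => ?_
    calc ∑ i ∈ F with cl i = c, w i * v i ≤ ∑ i ∈ F with cl i = c, w (r c) * v i := by
          refine Finset.sum_le_sum fun i hi => mul_le_mul_of_nonneg_right ?_ (hv i)
          exact hrmax c hc i (Finset.mem_filter.1 hi).1 (Finset.mem_filter.1 hi).2
      _ = w (r c) * ∑ i ∈ F with cl i = c, v i := (Finset.mul_sum _ _ _).symm
      _ ≤ w (r c) := mul_le_of_le_one_right (hw _) (hC c)
  linarith

/-- In a complete orthogonal family for `P * g` that splits into classes modulo `G`, with `g`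
separating points of a class and `P` separating classes, `‖P‖²` on a class is at most the
contribution of that class. -/
theorem norm_sq_le_tsum_class {E : Type*} [AddCommGroup E] {P g : E → ℂ} (hP : IsBessel P)
    (hg : IsBessel g) (G : AddSubgroup E) {S : Set E}
    (hPS : ∀ a ∈ S, ∀ b ∈ S, a - b ∉ G → P (a - b) = 0)
    (hgS : ∀ a ∈ S, ∀ b ∈ S, a ≠ b → a - b ∈ G → g (a - b) = 0)
    (x : E) (hsum : ∑' a : S, ‖P (x - a)‖ ^ 2 * ‖g (x - a)‖ ^ 2 = 1) {c a : E}
    (ha : a ∈ {a | a ∈ S ∧ a - c ∈ G}) :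
    ‖P (x - a)‖ ^ 2 ≤
      ∑' b : {a | a ∈ S ∧ a - c ∈ G}, ‖P (x - b)‖ ^ 2 * ‖g (x - b)‖ ^ 2 := by
  classical
  set C : Set E := {a | a ∈ S ∧ a - c ∈ G} with hCdef
  have hgC : ∀ a ∈ C, ∀ b ∈ C, a ≠ b → g (a - b) = 0 := fun a ha b hb hab =>
    hgS a ha.1 b hb.1 hab (by simpa using G.sub_mem ha.2 hb.2)
  have hCsum : Summable fun b : C => ‖P (x - b)‖ ^ 2 * ‖g (x - b)‖ ^ 2 :=
    Summable.of_nonneg_of_le (fun _ => by positivity)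
      (fun b => mul_le_of_le_one_left (by positivity) (hP.norm_sq_le_one _)) (hg.summable hgC x)
  -- A divergent `tsum` has value `0`, so the value `1` already gives summability.
  have hS : Summable fun a : S => ‖P (x - a)‖ ^ 2 * ‖g (x - a)‖ ^ 2 := by
    by_contra h
    rw [tsum_eq_zero_of_not_summable h] at hsum
    exact zero_ne_one hsum
  -- The bound is uniform in `F`, so it passes to the full sum, which is `1`; cancelling `1` leaves
  -- the claim.
  have key : ∀ F : Finset S, ∑ b ∈ F, ‖P (x - b)‖ ^ 2 * ‖g (x - b)‖ ^ 2 ≤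
      1 - ‖P (x - a)‖ ^ 2 + ∑' b : C, ‖P (x - b)‖ ^ 2 * ‖g (x - b)‖ ^ 2 := by
    intro F
    have h := sum_mul_le_of_transversal F (fun b : S => (QuotientAddGroup.mk (b : E) : E ⧸ G))
      (fun b => ‖P (x - b)‖ ^ 2) (fun b => ‖g (x - b)‖ ^ 2) (fun _ => by positivity)
      (fun _ => by positivity) ?_ ?_ ⟨a, ha.1⟩
    · refine h.trans (add_le_add_right ?_ _)
      have hmem : ∀ b ∈ F.filter
          (fun b : S => (QuotientAddGroup.mk (b : E) : E ⧸ G) = QuotientAddGroup.mk a),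
          (b : E) ∈ C := by
        intro b hb
        refine ⟨b.2, ?_⟩
        have h1 := QuotientAddGroup.eq.1 (Finset.mem_filter.1 hb).2
        have h2 := G.sub_mem ha.2 h1
        convert h2 using 1
        abel
      have h3 := hCsum.sum_le_tsum (((F.filter
          (fun b : S => (QuotientAddGroup.mk (b : E) : E ⧸ G) = QuotientAddGroup.mk a)).map
          (Function.Embedding.subtype _)).subtype (· ∈ C)) fun _ _ => by positivity
      refine le_trans (le_of_eq ?_) h3
      rw [Finset.sum_subtype_of_mem (fun b : E => ‖P (x - b)‖ ^ 2 * ‖g (x - b)‖ ^ 2),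
        Finset.sum_map]
      · rfl
      · intro b hb
        obtain ⟨b', hb', rfl⟩ := Finset.mem_map.1 hb
        exact hmem b' hb'
    · intro T hT
      have := hP (T.map (Function.Embedding.subtype _)) (by
        simp only [Finset.mem_map]
        rintro _ ⟨b, hb, rfl⟩ _ ⟨d, hd, rfl⟩ hbd
        refine hPS b b.2 d d.2 fun h => hbd ?_
        have : b = d := hT hb hd (QuotientAddGroup.eq.2 (by
          rw [← neg_mem_iff]; convert h using 1; simp [sub_eq_add_neg, add_comm]))
        rw [this]) x
      simpa using this
    · intro q
      have := hg ((F.filter fun b : S => (QuotientAddGroup.mk (b : E) : E ⧸ G) = q).map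
        (Function.Embedding.subtype _)) (by
        simp only [Finset.mem_map, Finset.mem_filter]
        rintro _ ⟨b, ⟨-, hb⟩, rfl⟩ _ ⟨d, ⟨-, hd⟩, rfl⟩ hbd
        refine hgS b b.2 d d.2 hbd ?_
        have := QuotientAddGroup.eq.1 (hb.trans hd.symm)
        rw [← neg_mem_iff] at this
        convert this using 1
        simp [sub_eq_add_neg, add_comm]) x
      simpa using this
  have := hS.tsum_le_of_sum_le key
  rw [hsum] at this
  linarith

/-! ### The refinement equation and the contradiction -/

section Core

variable {E : Type*} [NormedAddCommGroup E] [NormedSpace ℝ E]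

theorem eq_prod_mul_of_refinement (B : E ≃L[ℝ] E) {m f : E → ℂ}
    (hf : ∀ x, f x = m (B x) * f (B x)) (k : ℕ) (x : E) :
    f x = (∏ j ∈ Finset.range k, m ((B ^ (j + 1)) x)) * f ((B ^ k) x) := by
  induction k with
  | zero => simp only [Finset.range_zero, Finset.prod_empty, one_mul, pow_zero]; rfl
  | succ k ih =>
    rw [ih, Finset.prod_range_succ, hf ((B ^ k) x), pow_succ' B k, mul_assoc]
    rfl

/-- The whole argument with measures removed: only the refinement equation, Bessel's inequality for
`f` and for the partial product, and the position of the zeros relative to `G` enter. -/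
theorem not_complete_of_refinement (B : E ≃L[ℝ] E) {m f : E → ℂ} (hmc : Continuous m)
    (hm0 : m 0 = 1) (hf : ∀ x, f x = m (B x) * f (B x))
    (hfz : ∀ x, f x = 0 → ∃ j, 1 ≤ j ∧ m ((B ^ j) x) = 0) (hfB : IsBessel f)
    (G : AddSubgroup E) (hG : (G : Set E).Countable) (k : ℕ) (hk : 1 ≤ k)
    (hPB : IsBessel fun x => ∏ j ∈ Finset.range k, m ((B ^ (j + 1)) x))
    (hne : ∃ z, m z = 0) (hsub : ∀ a b, m a = 0 → m b = 0 → a - b ∉ G → m (a - b) = 0)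
    (hdisj : ∀ j, 1 ≤ j → j ≤ k → ∀ x, m ((B ^ j) x) = 0 → x ∉ G)
    (hint : ∀ j, k < j → ∀ x, m ((B ^ j) x) = 0 → x ∈ G)
    (S : Set E) (hS : ∀ a ∈ S, ∀ b ∈ S, a ≠ b → f (a - b) = 0)
    (hsum : ∀ x, ∑' a : S, ‖f (x - a)‖ ^ 2 = 1) : False := by
  obtain ⟨z, hz⟩ := hne
  have hBadd : ∀ i j x, (B ^ (i + j)) x = (B ^ i) ((B ^ j) x) := fun i j x => by
    rw [pow_add]; rfl
  -- Complements of countable sets are dense only in positive dimension.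
  have hnt : Nontrivial E := ⟨z, 0, by rintro rfl; rw [hm0] at hz; exact one_ne_zero hz⟩
  set P : E → ℂ := fun x => ∏ j ∈ Finset.range k, m ((B ^ (j + 1)) x) with hPdef
  set g : E → ℂ := fun x => f ((B ^ k) x) with hgdef
  have hfPg : ∀ x, f x = P x * g x := eq_prod_mul_of_refinement B hf k
  have hgB : IsBessel g :=
    hfB.comp_injective ((B ^ k : E ≃L[ℝ] E) : E →+ E) (B ^ k).injective
  have hPc : Continuous P :=
    continuous_finsetProd _ fun j _ => hmc.comp (B ^ (j + 1)).continuous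
  have hP0 : P 0 = 1 := by simp [hPdef, hm0]
  have hPz : ∀ x, P x = 0 ↔ ∃ j, 1 ≤ j ∧ j ≤ k ∧ m ((B ^ j) x) = 0 := by
    intro x
    simp only [hPdef, Finset.prod_eq_zero_iff, Finset.mem_range]
    constructor
    · rintro ⟨j, hj, h⟩; exact ⟨j + 1, by omega, by omega, h⟩
    · rintro ⟨j, h1, h2, h⟩
      exact ⟨j - 1, by omega, by rwa [Nat.sub_add_cancel h1]⟩
  have hgz : ∀ x, g x = 0 → ∃ j, k < j ∧ m ((B ^ j) x) = 0 := by
    intro x hx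
    obtain ⟨j, hj, h⟩ := hfz _ hx
    exact ⟨j + k, by omega, by rw [hBadd]; exact h⟩
  have hfP : ∀ x, f x = 0 → x ∉ G → P x = 0 := by
    intro x hx hxG
    rcases mul_eq_zero.1 ((hfPg x).symm.trans hx) with h | h
    · exact h
    · obtain ⟨j, hj, h⟩ := hgz x h
      exact absurd (hint j hj x h) hxG
  have hfg : ∀ x, f x = 0 → x ∈ G → g x = 0 := by
    intro x hx hxG
    rcases mul_eq_zero.1 ((hfPg x).symm.trans hx) with h | h
    · obtain ⟨j, h1, h2, h⟩ := (hPz x).1 h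
      exact absurd hxG (hdisj j h1 h2 x h)
    · exact h
  -- The inverse of `B ^ (k + 1)` carries the zeros of `m` into the countable group `G`.
  have hmcount : {x | m x = 0}.Countable := by
    refine (hG.image (B ^ (k + 1))).mono ?_
    intro x hx
    refine ⟨(B ^ (k + 1)).symm x, ?_, by simp⟩
    exact hint (k + 1) (by omega) _ (by simpa using hx)
  have hPcount : {x | P x = 0}.Countable := by
    have : {x | P x = 0} ⊆ ⋃ j : ℕ, (B ^ j) ⁻¹' {x | m x = 0} := by
      intro x hx
      obtain ⟨j, -, -, h⟩ := (hPz x).1 hx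
      exact Set.mem_iUnion.2 ⟨j, h⟩
    exact (Set.countable_iUnion fun j => hmcount.preimage (B ^ j).injective).mono this
  have hgcount : {x | g x = 0}.Countable := by
    have : {x | g x = 0} ⊆ ⋃ j : ℕ, (B ^ j) ⁻¹' {x | m x = 0} := by
      intro x hx
      obtain ⟨j, -, h⟩ := hgz x hx
      exact Set.mem_iUnion.2 ⟨j, h⟩
    exact (Set.countable_iUnion fun j => hmcount.preimage (B ^ j).injective).mono this
  obtain ⟨⟨c, hc⟩⟩ : Nonempty S := by
    by_contra h
    rw [not_nonempty_iff] at h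
    have := hsum 0
    simp at this
  set C : Set E := {a | a ∈ S ∧ a - c ∈ G} with hCdef
  have hcC : c ∈ C := ⟨hc, by simp⟩
  have hgC : ∀ a ∈ C, ∀ b ∈ C, a ≠ b → g (a - b) = 0 := fun a ha b hb hab =>
    hfg _ (hS a ha.1 b hb.1 hab) (by simpa using G.sub_mem ha.2 hb.2)
  -- the weights of the class of `c`
  have hclass : ∀ x, (∀ a ∈ C, g (x - a) ≠ 0 → ‖P (x - a)‖ ^ 2 =
        ∑' b : C, ‖P (x - b)‖ ^ 2 * ‖g (x - b)‖ ^ 2) ∧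
      (P (x - c) ≠ 0 → ∑' b : C, ‖g (x - b)‖ ^ 2 = 1) := by
    intro x
    have hle : ∀ a : C, ‖P (x - a)‖ ^ 2 ≤ ∑' b : C, ‖P (x - b)‖ ^ 2 * ‖g (x - b)‖ ^ 2 := by
      intro a
      refine norm_sq_le_tsum_class hPB hgB G (fun a ha b hb hab => ?_)
        (fun a ha b hb hab h => hfg _ (hS a ha b hb hab) h) x ?_ a.2
      · refine hfP _ (hS a ha b hb ?_) hab
        rintro rfl
        exact hab (by simp)
      · rw [← hsum x]
        exact tsum_congr fun a => by rw [hfPg, norm_mul, mul_pow]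
    have hsm : Summable fun b : C => ‖P (x - b)‖ ^ 2 * ‖g (x - b)‖ ^ 2 :=
      Summable.of_nonneg_of_le (fun _ => by positivity)
        (fun b => mul_le_of_le_one_left (by positivity) (hPB.norm_sq_le_one _))
        (hgB.summable hgC x)
    -- Here `s` is the class sum itself, so the last hypothesis is `le_rfl`; the bound `hle` is what
    -- forces equality.
    obtain ⟨h1, h2⟩ := eq_of_le_weighted_tsum (w := fun b : C => ‖P (x - b)‖ ^ 2)
      (v := fun b : C => ‖g (x - b)‖ ^ 2) (fun _ => by positivity) (hgB.summable hgC x)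
      (hgB.tsum_le_one hgC x) (tsum_nonneg fun _ => by positivity) hle hsm le_rfl
    refine ⟨fun a ha hga => h1 ⟨a, ha⟩ (by simpa using hga), fun hPc => h2 ?_⟩
    have h3 := hle ⟨c, hcC⟩
    have : 0 < ‖P (x - c)‖ ^ 2 := by positivity
    exact (this.trans_le h3).ne'
  have hdense : ∀ Y : Set E, Y.Countable → Dense Yᶜ := fun Y hY => hY.dense_compl ℝ
  -- Off the countably many `x` with `g (x - a) = 0` or `g (x - c) = 0`, both sides equal the same
  -- class sum; continuity does the rest.
  have hperiod : ∀ a ∈ C, ∀ x, ‖P (x - a)‖ ^ 2 = ‖P (x - c)‖ ^ 2 := by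
    intro a ha
    have hd := hdense ((fun x => x - a) ⁻¹' {x | g x = 0} ∪ (fun x => x - c) ⁻¹' {x | g x = 0})
      ((hgcount.preimage (sub_left_injective)).union (hgcount.preimage (sub_left_injective)))
    refine fun x => congrFun (Continuous.ext_on hd (f := fun x => ‖P (x - a)‖ ^ 2)
      (g := fun x => ‖P (x - c)‖ ^ 2) (by fun_prop) (by fun_prop) fun x hx => ?_) x
    simp only [Set.compl_union, Set.mem_inter_iff, Set.mem_compl_iff, Set.mem_preimage,
      Set.mem_ofPred_eq] at hx
    exact ((hclass x).1 a ha hx.1).trans ((hclass x).1 c hcC hx.2).symm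
  have hlat : ∀ a ∈ C, (B ^ k) (a - c) ∈ G := by
    intro a ha
    by_cases hac : a = c
    · simp [hac]
    have hper : ∀ x, P x = 0 → P (x + (a - c)) = 0 := by
      intro x hx
      have := hperiod a ha (x + a)
      rw [add_sub_cancel_right, hx, add_sub_assoc] at this
      simpa using this.symm
    obtain ⟨i, hi, hiz⟩ := hgz _ (hgC a ha c hcC hac)
    -- `u` is a zero of the last factor of `P`, so by periodicity `u + (a - c)` is a zero of some
    -- factor `j ≤ k`.
    set u := (B ^ k).symm z with hu
    have hBu : (B ^ k) u = z := by simp [hu]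
    obtain ⟨j, hj1, hjk, hj⟩ := (hPz _).1 (hper u ((hPz u).2 ⟨k, hk, le_rfl, by rwa [hBu]⟩))
    have hBs : ∀ j x, (B ^ (j + 1)) (B.symm x) = (B ^ j) x := fun j x => by
      rw [hBadd, pow_one]; simp
    have hG1 : B.symm (u + (a - c)) ∈ G := by
      rw [map_add]
      refine G.add_mem ?_ ?_
      · exact hint (k + 1) (by omega) _ (by rw [hBs, hBu]; exact hz)
      · exact hint (i + 1) (by omega) _ (by rw [hBs]; exact hiz)
    -- Applying `B.symm` raises every index by one: it sends `u` and `a - c` into `G`, while a zero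
    -- of index `j + 1 ≤ k` would lie outside `G`.
    have hjk' : j = k := by
      by_contra hne
      exact hdisj (j + 1) (by omega) (by omega) _ (by rw [hBs]; exact hj) hG1
    subst hjk'
    by_contra hnG
    -- This exhibits `(B ^ k) (a - c)` as a difference of two zeros of `m`, so `hsub` applies.
    have h1 : (B ^ j) (a - c) = (B ^ j) (u + (a - c)) - z := by
      rw [map_add, hBu, add_sub_cancel_left]
    rw [h1] at hnG
    have h2 := hsub _ _ hj hz hnG
    rw [← h1] at h2
    -- At `x = a` the period relation reads `‖P 0‖ = ‖P (a - c)‖`, that is `1 = 0`.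
    have h3 := hperiod a ha a
    rw [sub_self, hP0, (hPz _).2 ⟨j, hj1, le_rfl, h2⟩] at h3
    simp at h3
  -- the rescaled class is again complete, and consists of a single class
  set S' : Set E := (B ^ k) '' C with hS'
  have hgS' : ∀ a ∈ S', ∀ b ∈ S', a ≠ b → g (a - b) = 0 := by
    rintro _ ⟨a, ha, rfl⟩ _ ⟨b, hb, rfl⟩ hab
    refine hfg _ ?_ ?_
    · rw [← map_sub]
      exact hgC a ha b hb fun h => hab (by rw [h])
    · have := G.sub_mem (hlat a ha) (hlat b hb)
      rwa [← map_sub, sub_sub_sub_cancel_right, map_sub] at this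
  -- Since `g = f ∘ B ^ k`, completeness of `C` for `g` is completeness of `S'` for `f`.
  have hcomplete : ∀ y, P (y - c) ≠ 0 → ∑' a : S', ‖f ((B ^ k) y - a)‖ ^ 2 = 1 := by
    intro y hy
    rw [← (hclass y).2 hy, ← (Equiv.Set.image (B ^ k) C (B ^ k).injective).tsum_eq]
    refine tsum_congr fun a => ?_
    rw [Equiv.Set.image_apply, ← map_sub]
  -- On `S'` the weights `‖g‖²` have mass at most `1` and `‖P‖² ≤ 1`, yet the products sum to `1`;
  -- so `‖P‖ = 1` wherever `g` does not vanish, and then everywhere by density.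
  have hone : ∀ y, ‖P ((B ^ k) (y - c))‖ ^ 2 = 1 := by
    have hd := hdense ((fun x => x - c) ⁻¹' {x | P x = 0} ∪
        (fun x => (B ^ k) (x - c)) ⁻¹' {x | g x = 0})
      ((hPcount.preimage sub_left_injective).union
        (hgcount.preimage ((B ^ k).injective.comp sub_left_injective)))
    refine fun x => congrFun (Continuous.ext_on hd (f := fun y => ‖P ((B ^ k) (y - c))‖ ^ 2)
      (g := fun _ => 1) (by fun_prop) (by fun_prop) fun x hx => ?_) x
    simp only [Set.compl_union, Set.mem_inter_iff, Set.mem_compl_iff, Set.mem_preimage,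
      Set.mem_ofPred_eq] at hx
    have hs := hcomplete x hx.1
    simp only [hfPg, norm_mul, mul_pow] at hs
    have hsm : Summable fun b : S' => ‖P ((B ^ k) x - b)‖ ^ 2 * ‖g ((B ^ k) x - b)‖ ^ 2 := by
      by_contra h
      rw [tsum_eq_zero_of_not_summable h] at hs
      exact zero_ne_one hs
    have h1 := (eq_of_le_weighted_tsum (w := fun b : S' => ‖P ((B ^ k) x - b)‖ ^ 2)
      (v := fun b : S' => ‖g ((B ^ k) x - b)‖ ^ 2) (fun _ => by positivity)
      (hgB.summable hgS' _) (hgB.tsum_le_one hgS' _) zero_le_one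
      (fun _ => hPB.norm_sq_le_one _) hsm hs.ge).1 ⟨(B ^ k) c, c, hcC, rfl⟩
    have h2 := h1 (by simpa [← map_sub] using hx.2)
    simpa [← map_sub] using h2
  -- The point is chosen so that `P` is evaluated at `B.symm z`, a zero of its first factor.
  have hfin := hone ((B ^ k).symm (B.symm z) + c)
  have : P (B.symm z) = 0 := (hPz _).2 ⟨1, le_rfl, hk, by simpa using hz⟩
  simp [this] at hfin

end Core

/-! ### Fourier transforms of measures and of self-affine averages -/

section Fourier

variable {n : ℕ}

/-- The Fourier transform `x ↦ ∫ e^{2πi⟨y, x⟩} dρ(y)`. -/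
noncomputable def fourierTransform (ρ : Measure (EuclideanSpace ℝ (Fin n)))
    (x : EuclideanSpace ℝ (Fin n)) : ℂ :=
  charFun ρ ((2 * Real.pi) • x)

theorem expFun_eq (l x : EuclideanSpace ℝ (Fin n)) :
    expFun l x = Complex.exp (⟪x, (2 * Real.pi) • l⟫ * Complex.I) := by
  rw [expFun, inner_smul_right, real_inner_comm]
  congr 1
  push_cast
  ring

theorem inner_expLp (ρ : Measure (EuclideanSpace ℝ (Fin n))) [IsProbabilityMeasure ρ]
    (a b : EuclideanSpace ℝ (Fin n)) :
    inner ℂ (expLp ρ a) (expLp ρ b) = fourierTransform ρ (b - a) := by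
  rw [L2.inner_def, fourierTransform, charFun_apply]
  refine integral_congr_ae ?_
  filter_upwards [(memLp_expFun ρ a).coeFn_toLp, (memLp_expFun ρ b).coeFn_toLp] with x ha hb
  simp only [expLp]
  rw [ha, hb, RCLike.inner_apply, expFun_eq, expFun_eq, ← Complex.exp_conj, ← Complex.exp_add]
  simp only [map_mul, Complex.conj_ofReal, Complex.conj_I, smul_sub, inner_sub_right]
  congr 1
  push_cast
  ring

theorem fourierTransform_zero (ρ : Measure (EuclideanSpace ℝ (Fin n))) [IsProbabilityMeasure ρ] :
    fourierTransform ρ 0 = 1 := by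
  simp [fourierTransform]

theorem continuous_fourierTransform (ρ : Measure (EuclideanSpace ℝ (Fin n)))
    [IsProbabilityMeasure ρ] : Continuous (fourierTransform ρ) :=
  (continuous_charFun (μ := ρ)).comp (continuous_const_smul _)

theorem norm_expLp_sq (ρ : Measure (EuclideanSpace ℝ (Fin n))) [IsProbabilityMeasure ρ]
    (a : EuclideanSpace ℝ (Fin n)) : ‖expLp ρ a‖ ^ 2 = 1 := by
  rw [norm_sq_eq_re_inner (𝕜 := ℂ), inner_expLp, sub_self, fourierTransform_zero, RCLike.one_re]

/-- Zeros of the transform at differences make the exponentials orthonormal in `L²(ρ)`; this is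
Bessel's inequality for the unit vector `expLp ρ x`. -/
theorem isBessel_fourierTransform (ρ : Measure (EuclideanSpace ℝ (Fin n)))
    [IsProbabilityMeasure ρ] : IsBessel (fourierTransform ρ) := by
  intro T hT x
  have ho : Orthonormal ℂ fun a : T => expLp ρ (a : EuclideanSpace ℝ (Fin n)) := by
    refine ⟨fun a => ?_, fun a b hab => ?_⟩
    · exact (pow_eq_one_iff_of_nonneg (norm_nonneg _) two_ne_zero).1 (norm_expLp_sq ρ _)
    · change inner ℂ (expLp ρ a.1) (expLp ρ b.1) = 0
      rw [inner_expLp]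
      exact hT b b.2 a a.2 fun h => hab (Subtype.ext h.symm)
  have := ho.sum_inner_products_le (s := Finset.univ) (expLp ρ x)
  rw [norm_expLp_sq] at this
  simp only [inner_expLp] at this
  rwa [← Finset.sum_coe_sort T]

theorem IsSpectrum.fourierTransform_sub_eq_zero {ρ : Measure (EuclideanSpace ℝ (Fin n))}
    [IsProbabilityMeasure ρ] {S : Set (EuclideanSpace ℝ (Fin n))} (hS : IsSpectrum ρ S) :
    ∀ a ∈ S, ∀ b ∈ S, a ≠ b → fourierTransform ρ (a - b) = 0 := by
  obtain ⟨-, e, he⟩ := hS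
  intro a ha b hb hab
  have : inner ℂ (e ⟨b, hb⟩) (e ⟨a, ha⟩) = 0 := e.orthonormal.2 (i := ⟨b, hb⟩) (j := ⟨a, ha⟩) fun h => hab (Subtype.ext_iff.1 h).symm
  rwa [he, he, inner_expLp] at this

/-- Parseval's identity for the unit vector `expLp ρ x`. -/
theorem IsSpectrum.tsum_eq_one {ρ : Measure (EuclideanSpace ℝ (Fin n))}
    [IsProbabilityMeasure ρ] {S : Set (EuclideanSpace ℝ (Fin n))} (hS : IsSpectrum ρ S)
    (x : EuclideanSpace ℝ (Fin n)) : ∑' a : S, ‖fourierTransform ρ (x - a)‖ ^ 2 = 1 := by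
  obtain ⟨-, e, he⟩ := hS
  have h := e.tsum_inner_mul_inner (expLp ρ x) (expLp ρ x)
  rw [inner_expLp, sub_self, fourierTransform_zero] at h
  have h2 : ∀ a : S, inner ℂ (expLp ρ x) (e a) * inner ℂ (e a) (expLp ρ x) =
      ((‖fourierTransform ρ (x - a)‖ ^ 2 : ℝ) : ℂ) := by
    intro a
    rw [← inner_conj_symm, he, inner_expLp, Complex.conj_mul', Complex.ofReal_pow]
  simp only [h2] at h
  rw [← Complex.ofReal_tsum] at h
  exact_mod_cast h

theorem continuous_maskPolynomial (D : Finset (EuclideanSpace ℝ (Fin n))) :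
    Continuous (maskPolynomial D) := by
  unfold maskPolynomial expFun
  fun_prop

theorem maskPolynomial_zero {D : Finset (EuclideanSpace ℝ (Fin n))} (hD : D.Nonempty) :
    maskPolynomial D 0 = 1 := by
  have : (D.card : ℂ) ≠ 0 := by simpa using hD.ne_empty
  simp [maskPolynomial, expFun, this]

/-- The average of the images of `ρ` under the maps `x ↦ A (x + d)`, `d ∈ D`. -/
noncomputable def averageMap (A : EuclideanSpace ℝ (Fin n) →L[ℝ] EuclideanSpace ℝ (Fin n))
    (D : Finset (EuclideanSpace ℝ (Fin n))) (ρ : Measure (EuclideanSpace ℝ (Fin n))) :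
    Measure (EuclideanSpace ℝ (Fin n)) :=
  (D.card : ℝ≥0∞)⁻¹ • ∑ d ∈ D, ρ.map (fun x => A (x + d))

theorem isProbabilityMeasure_averageMap
    (A : EuclideanSpace ℝ (Fin n) →L[ℝ] EuclideanSpace ℝ (Fin n))
    {D : Finset (EuclideanSpace ℝ (Fin n))} (hD : D.Nonempty)
    (ρ : Measure (EuclideanSpace ℝ (Fin n))) [IsProbabilityMeasure ρ] :
    IsProbabilityMeasure (averageMap A D ρ) := by
  have hc0 : (D.card : ℝ≥0∞) ≠ 0 := by simpa using hD.ne_empty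
  have hmeas : ∀ d, Measurable (fun x => A (x + d)) := fun d => by fun_prop
  refine ⟨?_⟩
  simp only [averageMap, Measure.smul_apply, Measure.finsetSum_apply,
    Measure.map_apply (hmeas _) .univ, Set.preimage_univ, measure_univ, Finset.sum_const,
    nsmul_eq_mul, mul_one, smul_eq_mul]
  exact ENNReal.inv_mul_cancel hc0 (ENNReal.natCast_ne_top _)

theorem fourierTransform_averageMap
    (A : EuclideanSpace ℝ (Fin n) →L[ℝ] EuclideanSpace ℝ (Fin n))
    (D : Finset (EuclideanSpace ℝ (Fin n))) (ρ : Measure (EuclideanSpace ℝ (Fin n)))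
    [IsProbabilityMeasure ρ] (x : EuclideanSpace ℝ (Fin n)) :
    fourierTransform (averageMap A D ρ) x =
      maskPolynomial D (A.adjoint x) * fourierTransform ρ (A.adjoint x) := by
  have hmeas : ∀ d, Measurable (fun x => A (x + d)) := fun d => by fun_prop
  set t := (2 * Real.pi) • x with ht
  have hint : ∀ d ∈ D, Integrable (fun y => Complex.exp (⟪y, t⟫ * Complex.I))
      (ρ.map (fun x => A (x + d))) := by
    intro d _
    have := Measure.isProbabilityMeasure_map (μ := ρ) (hmeas d).aemeasurable
    refine Integrable.of_bound (C := 1) (by fun_prop) (Eventually.of_forall fun x => ?_)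
    rw [Complex.norm_exp_ofReal_mul_I]
  have e2 : ((D.card : ℝ≥0∞)⁻¹.toReal) = (D.card : ℝ)⁻¹ := by simp
  rw [fourierTransform, ← ht, averageMap, charFun_apply, integral_smul_measure,
    integral_finsetSum_measure hint, maskPolynomial, mul_assoc, Finset.sum_mul, e2,
    Complex.real_smul, Complex.ofReal_inv, Complex.ofReal_natCast]
  congr 1
  refine Finset.sum_congr rfl fun d _ => ?_
  rw [integral_map (hmeas d).aemeasurable (by fun_prop), fourierTransform, ← map_smul, ← ht,
    charFun_apply, ← integral_const_mul]
  refine integral_congr_ae (Eventually.of_forall fun y => ?_)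
  simp only [expFun]
  rw [← Complex.exp_add, ContinuousLinearMap.adjoint_inner_right,
    ContinuousLinearMap.adjoint_inner_right, map_add, inner_add_left]
  congr 1
  rw [ht, inner_smul_right, inner_smul_right]
  push_cast
  ring

/-- The measure is the `k`-fold `averageMap` of the Dirac mass at `0`. It is needed so that the
partial product `P` inherits Bessel's inequality. -/
theorem exists_fourierTransform_eq_prod
    (A : EuclideanSpace ℝ (Fin n) →L[ℝ] EuclideanSpace ℝ (Fin n))
    {D : Finset (EuclideanSpace ℝ (Fin n))} (hD : D.Nonempty) (k : ℕ) :
    ∃ ρ : Measure (EuclideanSpace ℝ (Fin n)), IsProbabilityMeasure ρ ∧ ∀ x,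
      fourierTransform ρ x = ∏ j ∈ Finset.range k, maskPolynomial D ((A.adjoint ^ (j + 1)) x) := by
  induction k with
  | zero => exact ⟨Measure.dirac 0, inferInstance, fun x => by simp [fourierTransform]⟩
  | succ k ih =>
    obtain ⟨ρ, hρ, h⟩ := ih
    refine ⟨averageMap A D ρ, isProbabilityMeasure_averageMap A hD ρ, fun x => ?_⟩
    rw [fourierTransform_averageMap, h, Finset.prod_range_succ', mul_comm]
    congr 1

/-- If no factor vanished, the zero would propagate along the orbit of `x` under `A.adjoint`, which
tends to `0`, where the transform is `1`. -/
theorem exists_maskPolynomial_eq_zero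
    (A : EuclideanSpace ℝ (Fin n) →L[ℝ] EuclideanSpace ℝ (Fin n))
    (hA : Summable fun k : ℕ => ‖A ^ k‖) (D : Finset (EuclideanSpace ℝ (Fin n)))
    (μ : Measure (EuclideanSpace ℝ (Fin n))) [IsProbabilityMeasure μ] (hμ : μ = averageMap A D μ)
    {x : EuclideanSpace ℝ (Fin n)} (hx : fourierTransform μ x = 0) :
    ∃ j, 1 ≤ j ∧ maskPolynomial D ((A.adjoint ^ j) x) = 0 := by
  by_contra! hne
  have hz : ∀ k : ℕ, fourierTransform μ ((A.adjoint ^ k) x) = 0 := by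
    intro k
    induction k with
    | zero => simpa using hx
    | succ k ih =>
      rw [hμ, fourierTransform_averageMap] at ih
      have h := (mul_eq_zero.1 ih).resolve_left (by
        have := hne (k + 1) (by omega)
        rwa [pow_succ'] at this)
      rw [pow_succ']
      exact h
  have hlim : Tendsto (fun k : ℕ => (A.adjoint ^ k) x) atTop (𝓝 0) := by
    refine squeeze_zero_norm (a := fun k => ‖A ^ k‖ * ‖x‖) (fun k => ?_) ?_
    · refine ((A.adjoint ^ k).le_opNorm x).trans (le_of_eq ?_)
      rw [← ContinuousLinearMap.star_eq_adjoint, ← star_pow, ContinuousLinearMap.star_eq_adjoint,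
        LinearIsometryEquiv.norm_map]
    · simpa using hA.tendsto_atTop_zero.mul_const ‖x‖
  have h := ((continuous_fourierTransform μ).tendsto 0).comp hlim
  rw [fourierTransform_zero] at h
  have h0 : fourierTransform μ ∘ (fun k : ℕ => (A.adjoint ^ k) x) = fun _ => 0 := funext hz
  rw [h0] at h
  exact zero_ne_one (tendsto_nhds_unique tendsto_const_nhds h)

end Fourier

/-! ### The matrix, the lattice and the final theorem -/

theorem IsExpanding.isUnit {n : ℕ} {M : Matrix (Fin n) (Fin n) ℝ} (hM : IsExpanding M) :
    IsUnit M := by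
  have hNu : IsUnit (Complex.ofRealHom.mapMatrix M) := by
    rw [← spectrum.zero_notMem_iff ℂ]
    intro h0
    have := hM 0 h0
    simp only [norm_zero] at this
    linarith
  rw [Matrix.isUnit_iff_isUnit_det, isUnit_iff_ne_zero] at hNu ⊢
  rw [← RingHom.map_det] at hNu
  intro h
  exact hNu (by rw [h, map_zero])

/-- The lattice `L⁻¹ ℤⁿ`. -/
def scaledLattice (n : ℕ) (L : ℝ) : AddSubgroup (EuclideanSpace ℝ (Fin n)) where
  carrier := {x | L • x ∈ intLattice n}
  zero_mem' := fun i => ⟨0, by simp⟩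
  add_mem' := fun ha hb i => by
    obtain ⟨k, hk⟩ := ha i
    obtain ⟨l, hl⟩ := hb i
    exact ⟨k + l, by rw [smul_add, PiLp.add_apply, hk, hl]; push_cast; rfl⟩
  neg_mem' := fun ha i => by
    obtain ⟨k, hk⟩ := ha i
    exact ⟨-k, by rw [smul_neg, PiLp.neg_apply, hk]; push_cast; rfl⟩

theorem mem_scaledLattice {n : ℕ} {L : ℝ} {x : EuclideanSpace ℝ (Fin n)} :
    x ∈ scaledLattice n L ↔ L • x ∈ intLattice n := Iff.rfl

theorem countable_scaledLattice (n : ℕ) {L : ℝ} (hL : L ≠ 0) :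
    (scaledLattice n L : Set (EuclideanSpace ℝ (Fin n))).Countable := by
  have : (scaledLattice n L : Set (EuclideanSpace ℝ (Fin n))) ⊆
      Set.range fun v : Fin n → ℤ => L⁻¹ • WithLp.toLp 2 fun i => (v i : ℝ) := by
    intro x hx
    choose v hv using (mem_scaledLattice.1 hx)
    refine ⟨v, ?_⟩
    rw [inv_smul_eq_iff₀ hL]
    ext i
    exact (hv i).symm
  exact (Set.countable_range _).mono this

end SelfAffine

/-- A non-spectrality criterion for self-affine measures. -/
theorem theorem4p3p1 (n : ℕ) (M : Matrix (Fin n) (Fin n) ℝ) (hM : IsExpanding M)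
    (D : Finset (EuclideanSpace ℝ (Fin n))) (hD : D.Nonempty)
    (L : ℝ) (hL : 0 < L) (j₀ : ℕ) (hj₀ : 2 ≤ j₀)
    (hne : ((L • (maskZeros D - maskZeros D)) \ intLattice n).Nonempty)
    (hsub : (L • (maskZeros D - maskZeros D)) \ intLattice n ⊆ L • maskZeros D)
    (hdisj : (L • ⋃ j ∈ Set.Icc 1 (j₀ - 1),
        Matrix.toEuclideanCLM (n := Fin n) (𝕜 := ℝ) (Mᴴ ^ j) '' maskZeros D) ∩ intLattice n = ∅)
    (hint : ∀ j, j₀ ≤ j →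
      L • (Matrix.toEuclideanCLM (n := Fin n) (𝕜 := ℝ) (Mᴴ ^ j) '' maskZeros D) ⊆ intLattice n) :
    ¬ IsSpectralMeasure (selfAffineMeasure M D hM hD) := by
  rintro ⟨S, hS⟩
  set μ := selfAffineMeasure M D hM hD with hμdef
  set A := Matrix.toEuclideanCLM (n := Fin n) (𝕜 := ℝ) M⁻¹ with hA
  have hμ : μ = averageMap A D μ := (isSelfAffineMeasure_selfAffineMeasure M D hM hD).2
  have hdet : IsUnit M.det := (Matrix.isUnit_iff_isUnit_det M).1 hM.isUnit
  set U := Matrix.toEuclideanCLM (n := Fin n) (𝕜 := ℝ) Mᴴ with hU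
  have hadj : A.adjoint = Matrix.toEuclideanCLM (n := Fin n) (𝕜 := ℝ) (M⁻¹)ᴴ := by
    rw [← ContinuousLinearMap.star_eq_adjoint, hA, ← map_star]
    rfl
  have hUA : U * A.adjoint = 1 := by
    rw [hadj, hU, ← map_mul, ← Matrix.conjTranspose_mul, Matrix.nonsing_inv_mul _ hdet,
      Matrix.conjTranspose_one, map_one]
  have hAU : A.adjoint * U = 1 := by
    rw [hadj, hU, ← map_mul, ← Matrix.conjTranspose_mul, Matrix.mul_nonsing_inv _ hdet,
      Matrix.conjTranspose_one, map_one]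
  -- `B` is the inverse of `M*`, so `m ((B ^ j) x) = 0` means that `x` lies in `M*ʲ Z(m)`.
  let B : EuclideanSpace ℝ (Fin n) ≃L[ℝ] EuclideanSpace ℝ (Fin n) :=
    ContinuousLinearEquiv.equivOfInverse A.adjoint U (fun x => DFunLike.congr_fun hUA x)
      (fun x => DFunLike.congr_fun hAU x)
  have hB : ∀ (j : ℕ) x, (B ^ j) x = (A.adjoint ^ j) x := by
    intro j
    induction j with
    | zero => intro x; rfl
    | succ j ih =>
      intro x
      rw [pow_succ', pow_succ']
      change B ((B ^ j) x) = A.adjoint ((A.adjoint ^ j) x)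
      rw [ih]
      rfl
  have hmem : ∀ (j : ℕ) x, maskPolynomial D ((B ^ j) x) = 0 →
      x ∈ Matrix.toEuclideanCLM (n := Fin n) (𝕜 := ℝ) (Mᴴ ^ j) '' maskZeros D := by
    intro j x hx
    refine ⟨(B ^ j) x, hx, ?_⟩
    rw [hB, map_pow]
    have : U ^ j * A.adjoint ^ j = 1 := by
      rw [← (show Commute U A.adjoint from hUA.trans hAU.symm).mul_pow, hUA, one_pow]
    exact DFunLike.congr_fun this x
  -- The cut is at `k = j₀ - 1`: indices up to `k` avoid the lattice, those above it fall into the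
  -- lattice.
  obtain ⟨ρ, hρ, hρP⟩ := exists_fourierTransform_eq_prod A hD (j₀ - 1)
  refine not_complete_of_refinement B (m := maskPolynomial D) (f := fourierTransform μ)
    (continuous_maskPolynomial D) (maskPolynomial_zero hD) (fun x => ?_) (fun x hx => ?_)
    (isBessel_fourierTransform μ) (scaledLattice n L) (countable_scaledLattice n hL.ne')
    (j₀ - 1) (by omega) ?_ ?_ (fun a b ha hb hab => ?_) (fun j h1 h2 x hx hxG => ?_)
    (fun j hj x hx => ?_) S hS.fourierTransform_sub_eq_zero hS.tsum_eq_one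
  · conv_lhs => rw [hμ]
    exact fourierTransform_averageMap A D μ x
  · obtain ⟨j, hj, h⟩ := exists_maskPolynomial_eq_zero A hM.summable D μ hμ hx
    exact ⟨j, hj, by rwa [hB]⟩
  · have : (fun x => ∏ j ∈ Finset.range (j₀ - 1), maskPolynomial D ((B ^ (j + 1)) x)) =
        fourierTransform ρ := funext fun x => by simp only [hρP, hB]
    rw [this]
    exact isBessel_fourierTransform ρ
  · obtain ⟨x, hx, -⟩ := hne
    obtain ⟨_, ⟨z, hz, -⟩, -⟩ := hx
    exact ⟨z, hz⟩
  · obtain ⟨z, hz, h⟩ := hsub ⟨Set.smul_mem_smul_set (Set.sub_mem_sub ha hb), hab⟩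
    rw [← smul_right_injective _ hL.ne' h]
    exact hz
  · have : L • x ∈ (∅ : Set (EuclideanSpace ℝ (Fin n))) := by
      rw [← hdisj]
      exact ⟨Set.smul_mem_smul_set (Set.mem_biUnion (Set.mem_Icc.2 ⟨h1, h2⟩) (hmem j x hx)), hxG⟩
    exact this
  · exact hint j (by omega) (Set.smul_mem_smul_set (hmem j x hx))
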